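/- Let $\mathbb{T}=\mathbb{R}/\mathbb{Z}$. A \emph{kernel function} is a function $K:(-1,0)\cup(0,1)\to\mathbb{R}$ that is concave on $(-1,0)$ and on $(0,1)$ and satisfies $\lim_{t\downarrow 0}K(t)=\lim_{t\uparrow 0}K(t)$ in $[-\infty,\infty)$. It is extended to $[-1,1]$ by its limits, with values in $\mathbb{R}\cup\{-\infty\}$. It is \emph{singular} if $K(0)=-\infty$, and \emph{periodic} if $K(t-1)=K(t)$ for $t\in(0,1)$; a periodic $K$ is regarded as a function on $\mathbb{T}$. An \emph{$n$-field function} is a function $J:\mathbb{T}\to\mathbb{R}\cup\{-\infty\}$ that is bounded above and finite at more than $n$ points of $\mathbb{T}$. For $n\ge 1$ let $\overline{L}\subset\mathbb{T}^n$ (respectively $L$) be the set of all $\mathbf{y}=(y_1,\dots,y_n)$ that have representatives $x_1,\dots,x_n\in\mathbb{R}$ with $x_1\le x_2\le\dots\le x_n\le x_1+1$ (respectively $x_1<x_2<\dots<x_n<x_1+1$). For $\nu_1,\dots,\nu_n>0$ and $\mathbf{y}\in\overline{L}$ put $$F(\mathbf{y},t)=J(t)+\sum_{j=1}^n\nu_jK(t-y_j),\qquad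 \overline{m}^*(\mathbf{y})=\sup_{t\in\mathbb{T}}F(\mathbf{y},t),\qquad m_j^*(\mathbf{y})=\sup_{t\in I_j^*(\mathbf{y})}F(\mathbf{y},t),$$ where $I_j^*(\mathbf{y})$ is the closed positively oriented arc from $y_j$ to $y_{j+1}$ (with $y_{n+1}=y_1$), which is a single point if $y_j=y_{j+1}$, except that $I_n^*(\mathbf{y})=\mathbb{T}$ if all nodes coincide (in particular if $n=1$). \textbf{Theorem.} Let $n\ge 1$ and $\nu_1,\dots,\nu_n>0$, let $K$ be a singular periodic kernel function (not necessarily strictly concave), and let $J$ be an arbitrary $n$-field function on $\mathbb{T}$. Then there exists a minimax point $\mathbf{w}^*\in\overline{L}$, that is, $\overline{m}^*(\mathbf{w}^*)=\inf_{\mathbf{y}\in\overline{L}}\overline{m}^*(\mathbf{y})$, which belongs to $L$ and is an equioscillation point: $m_1^*(\mathbf{w}^*)=\dots=m_n^*(\mathbf{w}^*)$. -/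

import Mathlib

open Set Filter Topology

noncomputable section

namespace SumOfTranslates

/-- The punctured interval `(-1,0) ∪ (0,1)`, the domain of a kernel function. -/
def kernelDomain : Set ℝ := Ioo (-1) 0 ∪ Ioo 0 1

/-- Kernel functions: concave on `(-1,0)` and on `(0,1)`, with equal (possibly infinite) one-sided
limits at `0`. Only the values of `K` on `kernelDomain` are relevant. -/
structure IsKernel (K : ℝ → ℝ) : Prop where
  concaveOn_neg : ConcaveOn ℝ (Ioo (-1) 0) K
  concaveOn_pos : ConcaveOn ℝ (Ioo 0 1) K
  limit_zero : ∃ l : EReal, Tendsto (fun t => (K t : EReal)) (𝓝[>] 0) (𝓝 l) ∧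
    Tendsto (fun t => (K t : EReal)) (𝓝[<] 0) (𝓝 l)

/-- The extension of a kernel function to `[-1,1]` by limits, with values in `ℝ ∪ {-∞}`. -/
def kernelExt (K : ℝ → ℝ) : ℝ → EReal :=
  extendFrom kernelDomain (fun t => (K t : EReal))

/-- The kernel function is singular: `K(0) = -∞`. -/
def IsSingular (K : ℝ → ℝ) : Prop := kernelExt K 0 = ⊥

/-- The kernel function is (extendable to a) `1`-periodic (function on `ℝ`). -/
def IsPeriodicKernel (K : ℝ → ℝ) : Prop := ∀ t ∈ Ioo (0 : ℝ) 1, K (t - 1) = K t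

/-- The `1`-periodic extension of a periodic kernel function, as a function on `𝕋 = ℝ/ℤ`. -/
def kernelTorus (K : ℝ → ℝ) : UnitAddCircle → EReal :=
  AddCircle.liftIco 1 0 (kernelExt K)

/-- (Periodic) external `n`-field functions `J : 𝕋 → ℝ ∪ {-∞}`: bounded above by a real number, and
finite at more than `n` points. -/
structure IsFieldFunction (n : ℕ) (J : UnitAddCircle → EReal) : Prop where
  bddAbove : ∃ C : ℝ, ∀ t, J t ≤ C
  finite_values : (n : ℕ∞) < {t | J t ≠ ⊥}.encard

/-- The sum of translates function `F(y,t) = J(t) + ∑ⱼ νⱼ K(t - yⱼ)` on the torus. -/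
def sumTranslates {n : ℕ} (ν : Fin n → ℝ) (K : ℝ → ℝ) (J : UnitAddCircle → EReal)
    (y : Fin n → UnitAddCircle) (t : UnitAddCircle) : EReal :=
  J t + ∑ j, (ν j : EReal) * kernelTorus K (t - y j)

/-- The open cyclic simplex `L`: node systems with `y₁ ≺ y₂ ≺ ⋯ ≺ yₙ (≺ y₁)`, that is, having
representatives `x₁ < x₂ < ⋯ < xₙ < x₁ + 1`. -/
def openCyclicSimplex (n : ℕ) : Set (Fin n → UnitAddCircle) :=
  {y | ∃ x : Fin n → ℝ, StrictMono x ∧ (∀ i j, x j < x i + 1) ∧ ∀ j, y j = (x j : UnitAddCircle)}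

/-- The closed cyclic simplex: node systems with `y₁ ≼ y₂ ≼ ⋯ ≼ yₙ (≼ y₁)`, that is, having
representatives `x₁ ≤ x₂ ≤ ⋯ ≤ xₙ ≤ x₁ + 1`. -/
def closedCyclicSimplex (n : ℕ) : Set (Fin n → UnitAddCircle) :=
  {y | ∃ x : Fin n → ℝ, Monotone x ∧ (∀ i j, x j ≤ x i + 1) ∧ ∀ j, y j = (x j : UnitAddCircle)}

/-- The length in `[0,1)` of the way from `a` to `b` in the positive direction. -/
def offset (a b : UnitAddCircle) : ℝ := (AddCircle.equivIco 1 0 (b - a) : ℝ)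

/-- The closed positively oriented arc from `a` to `b` (the single point `a` if `a = b`). -/
def arc (a b : UnitAddCircle) : Set UnitAddCircle := {t | offset a t ≤ offset a b}

/-- The `j`-th arc between the consecutive nodes `yⱼ` and `yⱼ₊₁`, indices being cyclic. If all
nodes coincide (in particular, if `n = 1`), then the last arc makes a full turn. -/
def nodeArc {n : ℕ} [NeZero n] (y : Fin n → UnitAddCircle) (j : Fin n) : Set UnitAddCircle :=
  {t | t ∈ arc (y j) (y (j + 1)) ∨ (j + 1 = 0 ∧ ∀ i, y i = y 0)}

/-- The arc maximum (supremum of `F(y,·)` on the `j`-th arc). -/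
def arcMax {n : ℕ} [NeZero n] (ν : Fin n → ℝ) (K : ℝ → ℝ) (J : UnitAddCircle → EReal)
    (y : Fin n → UnitAddCircle) (j : Fin n) : EReal :=
  ⨆ t ∈ nodeArc y j, sumTranslates ν K J y t

/-- The global supremum of `F(y,·)` on the torus. -/
def maxValue {n : ℕ} (ν : Fin n → ℝ) (K : ℝ → ℝ) (J : UnitAddCircle → EReal)
    (y : Fin n → UnitAddCircle) : EReal :=
  ⨆ t, sumTranslates ν K J y t

/-- The minimax value on the closed cyclic simplex. -/
def minimaxValue {n : ℕ} (ν : Fin n → ℝ) (K : ℝ → ℝ) (J : UnitAddCircle → EReal) : EReal :=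
  ⨅ y ∈ closedCyclicSimplex n, maxValue ν K J y

/-- Minimax points on the closed cyclic simplex. -/
def IsMinimaxPoint {n : ℕ} (ν : Fin n → ℝ) (K : ℝ → ℝ) (J : UnitAddCircle → EReal)
    (w : Fin n → UnitAddCircle) : Prop :=
  w ∈ closedCyclicSimplex n ∧ maxValue ν K J w = minimaxValue ν K J

/-- Equioscillation points: all arc maxima are equal. -/
def IsEquioscillationPoint {n : ℕ} [NeZero n] (ν : Fin n → ℝ) (K : ℝ → ℝ)
    (J : UnitAddCircle → EReal) (w : Fin n → UnitAddCircle) : Prop :=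
  ∀ i j, arcMax ν K J w i = arcMax ν K J w j

end SumOfTranslates

end

noncomputable section

namespace SumOfTranslates

/-! Everything is exponentiated. Singularity and periodicity make `exp K`, set to `0` at the
integers, continuous on the line; `exp J` becomes a bounded weight `w ≥ 0` with no regularity.
Maximizing `F` means maximizing `w` times a product jointly continuous in nodes and point, and such
suprema depend continuously on the nodes (`continuous_weightedSup`). So minimizers exist by
compactness.

Replace `K` by `K + ε s(1 - s)`, `ε > 0`. Suppose a minimizer has an arc whose supremum lies below
the global one. Widen that arc slightly, moving the nodes at its two ends apart with the weighted
centre preserved. By strict concavity the product on the complementary arc shrinks by a fixed factor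
less than `1` (`regProd_spread_le`), while by continuity the supremum on the widened arc stays below
the old global one. This contradicts minimality, so all arc suprema agree
(`regArcMax_eq_of_minimal`).

For `ε = 0` the decrease need not be strict. Hence minimizers for `ε → 0` are taken along a
convergent subsequence; joint continuity in `(ε, x)` preserves both minimality and equioscillation
(`exists_minimal_equioscillating`). The common value is positive because `J` is finite at some point
that is not a node. A degenerate arc would have supremum `0`, so the limit lies in the open simplex.
-/

/-- The exponential of the `1`-periodic extension of `K`, vanishing at the integers. -/
def expKernel (K : ℝ → ℝ) (s : ℝ) : ℝ :=
  if Int.fract s = 0 then 0 else Real.exp (K (Int.fract s))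

/-- The `1`-periodic extension of the strictly concave function `s ↦ s (1 - s)` on `[0,1]`. -/
def bump (s : ℝ) : ℝ := Int.fract s * (1 - Int.fract s)

/-- The exponential of the `1`-periodic extension of `K + ε bump`. -/
def regKernel (K : ℝ → ℝ) (ε s : ℝ) : ℝ := expKernel K s * Real.exp (ε * bump s)

/-- The exponential of the pure sum of translates of `K + ε bump`. -/
def regProd {n : ℕ} (ν : Fin n → ℝ) (K : ℝ → ℝ) (ε : ℝ) (x : Fin n → ℝ) (t : ℝ) : ℝ :=
  ∏ j, regKernel K ε (t - x j) ^ ν j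

/-- The supremum of `w f` over the window `[-1,3]`. -/
def weightedSup (w f : ℝ → ℝ) : ℝ := ⨆ t : Icc (-1 : ℝ) 3, w t * f t

/-- The node following the `j`-th one on the line, the first node being repeated after a full
turn. -/
def nextNode {n : ℕ} [NeZero n] (x : Fin n → ℝ) (j : Fin n) : ℝ :=
  x (j + 1) + if j + 1 = 0 then 1 else 0

/-- The weighted supremum of the regularized product over the torus. -/
def regMax {n : ℕ} (ν : Fin n → ℝ) (K w : ℝ → ℝ) (ε : ℝ) (x : Fin n → ℝ) : ℝ :=
  weightedSup w (regProd ν K ε x)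

/-- The weighted supremum of the regularized product over the `j`-th arc. -/
def regArcMax {n : ℕ} [NeZero n] (ν : Fin n → ℝ) (K w : ℝ → ℝ) (j : Fin n) (ε : ℝ)
    (x : Fin n → ℝ) : ℝ :=
  weightedSup w fun t => regProd ν K ε x (max (x j) (min t (nextNode x j)))

/-- The lifted closed cyclic simplex. -/
def liftedSimplex (n : ℕ) : Set (Fin n → ℝ) := {x | Monotone x ∧ ∀ i j, x j ≤ x i + 1}

/-! ### Suprema against a bounded, possibly discontinuous weight. -/

theorem bddAbove_weighted {w f : ℝ → ℝ} {C : ℝ} (hw : ∀ t, |w t| ≤ C) (hf : Continuous f) :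
    BddAbove (range fun t : Icc (-1 : ℝ) 3 => w t * f t) := by
  obtain ⟨D, hD⟩ := isCompact_Icc.exists_bound_of_continuousOn (s := Icc (-1 : ℝ) 3)
    hf.continuousOn
  refine ⟨C * D, ?_⟩
  rintro _ ⟨t, rfl⟩
  refine (le_abs_self _).trans ?_
  rw [abs_mul]
  exact mul_le_mul (hw t) (hD t t.2) (abs_nonneg _) ((abs_nonneg _).trans (hw 0))

theorem le_weightedSup {w f : ℝ → ℝ} {C : ℝ} (hw : ∀ t, |w t| ≤ C) (hf : Continuous f)
    {t : ℝ} (ht : t ∈ Icc (-1 : ℝ) 3) : w t * f t ≤ weightedSup w f :=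
  le_ciSup (bddAbove_weighted hw hf) ⟨t, ht⟩

theorem weightedSup_le {w f : ℝ → ℝ} {B : ℝ} (h : ∀ t ∈ Icc (-1 : ℝ) 3, w t * f t ≤ B) :
    weightedSup w f ≤ B := by
  have : Nonempty (Icc (-1 : ℝ) 3) := ⟨⟨0, by norm_num, by norm_num⟩⟩
  exact ciSup_le fun t => h t t.2

/-- Currying gives a continuous map into the continuous functions on the compact window with the sup
norm, and the supremum against `w` is `C`-Lipschitz there. -/
theorem continuous_weightedSup {X : Type*} [TopologicalSpace X] {w : ℝ → ℝ} {C : ℝ}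
    (hw : ∀ t, |w t| ≤ C) {g : X → ℝ → ℝ} (hg : Continuous (Function.uncurry g)) :
    Continuous fun p => weightedSup w (g p) := by
  let G : C(X × Icc (-1 : ℝ) 3, ℝ) :=
    ⟨fun p => g p.1 p.2, hg.comp (continuous_fst.prodMk (continuous_subtype_val.comp
      continuous_snd))⟩
  have hC : 0 ≤ C := (abs_nonneg _).trans (hw 0)
  have : Nonempty (Icc (-1 : ℝ) 3) := ⟨⟨0, by norm_num, by norm_num⟩⟩
  have hb : ∀ f : C(Icc (-1 : ℝ) 3, ℝ), BddAbove (range fun t : Icc (-1 : ℝ) 3 => w t * f t) := by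
    intro f
    refine ⟨C * ‖f‖, ?_⟩
    rintro _ ⟨t, rfl⟩
    refine (le_abs_self _).trans ?_
    rw [abs_mul]
    exact mul_le_mul (hw t) (f.norm_coe_le_norm t) (abs_nonneg _) hC
  have hL : LipschitzWith C.toNNReal fun f : C(Icc (-1 : ℝ) 3, ℝ) => ⨆ t : Icc (-1 : ℝ) 3, w t * f t := by
    refine LipschitzWith.of_le_add_mul _ fun f f' => ciSup_le fun t => ?_
    have h1 : w t * f' t ≤ ⨆ t : Icc (-1 : ℝ) 3, w t * f' t := le_ciSup (hb f') t
    have h2 : w t * (f t - f' t) ≤ C * dist f f' := by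
      refine (le_abs_self _).trans ?_
      rw [abs_mul]
      exact mul_le_mul (hw t) (ContinuousMap.dist_apply_le_dist (f := f) (g := f') t)
        (abs_nonneg _) hC
    rw [Real.coe_toNNReal _ hC]
    linarith
  exact hL.continuous.comp G.curry.continuous

/-! ### The regularized kernel and product: periodicity, zeros, continuity. -/

theorem expKernel_nonneg (K : ℝ → ℝ) (s : ℝ) : 0 ≤ expKernel K s := by
  unfold expKernel; split_ifs <;> positivity

theorem regKernel_nonneg (K : ℝ → ℝ) (ε s : ℝ) : 0 ≤ regKernel K ε s :=
  mul_nonneg (expKernel_nonneg K s) (Real.exp_pos _).le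

theorem regProd_nonneg {n : ℕ} (ν : Fin n → ℝ) (K : ℝ → ℝ) (ε : ℝ) (x : Fin n → ℝ) (t : ℝ) :
    0 ≤ regProd ν K ε x t :=
  Finset.prod_nonneg fun _ _ => Real.rpow_nonneg (regKernel_nonneg _ _ _) _

theorem regKernel_add_int (K : ℝ → ℝ) (ε s : ℝ) (m : ℤ) :
    regKernel K ε (s + m) = regKernel K ε s := by
  simp [regKernel, expKernel, bump]

theorem regKernel_int (K : ℝ → ℝ) (ε : ℝ) (m : ℤ) : regKernel K ε m = 0 := by
  simp [regKernel, expKernel]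

theorem regKernel_of_mem {K : ℝ → ℝ} {ε s : ℝ} (hs : s ∈ Ioo (0 : ℝ) 1) :
    regKernel K ε s = Real.exp (K s + ε * (s * (1 - s))) := by
  have : Int.fract s = s := Int.fract_eq_self.2 ⟨hs.1.le, hs.2⟩
  simp [regKernel, expKernel, bump, this, hs.1.ne', Real.exp_add]

theorem regProd_add_int {n : ℕ} (ν : Fin n → ℝ) (K : ℝ → ℝ) (ε : ℝ) (x : Fin n → ℝ) (t : ℝ)
    (m : ℤ) : regProd ν K ε x (t + m) = regProd ν K ε x t := by
  refine Finset.prod_congr rfl fun j _ => ?_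
  rw [show t + m - x j = t - x j + m by ring, regKernel_add_int]

theorem regProd_eq_zero {n : ℕ} {ν : Fin n → ℝ} (hν : ∀ j, 0 < ν j) (K : ℝ → ℝ) (ε : ℝ)
    {x : Fin n → ℝ} {t : ℝ} {j : Fin n} {m : ℤ} (h : t - x j = m) :
    regProd ν K ε x t = 0 :=
  Finset.prod_eq_zero (Finset.mem_univ j) <| by
    rw [h, regKernel_int, Real.zero_rpow (hν j).ne']

theorem continuous_bump : Continuous bump :=
  ContinuousOn.comp_fract'' (f := fun s : ℝ => s * (1 - s)) (by fun_prop) (by norm_num)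

theorem continuous_regProd {n : ℕ} {ν : Fin n → ℝ} (hν : ∀ j, 0 < ν j) {K : ℝ → ℝ}
    (hK : Continuous (expKernel K)) :
    Continuous fun p : (ℝ × (Fin n → ℝ)) × ℝ => regProd ν K p.1.1 p.1.2 p.2 := by
  refine continuous_finsetProd _ fun j _ => ?_
  have hs : Continuous fun p : (ℝ × (Fin n → ℝ)) × ℝ => p.2 - p.1.2 j := by fun_prop
  refine Continuous.rpow_const ?_ fun _ => Or.inr (hν j).le
  exact (hK.comp hs).mul (Real.continuous_exp.comp
    ((continuous_fst.comp continuous_fst).mul (continuous_bump.comp hs)))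

theorem continuous_regMax {n : ℕ} {ν : Fin n → ℝ} (hν : ∀ j, 0 < ν j) {K w : ℝ → ℝ}
    (hK : Continuous (expKernel K)) {C : ℝ} (hw : ∀ t, |w t| ≤ C) :
    Continuous fun p : ℝ × (Fin n → ℝ) => regMax ν K w p.1 p.2 :=
  continuous_weightedSup (g := fun p : ℝ × (Fin n → ℝ) => regProd ν K p.1 p.2) hw
    (continuous_regProd hν hK)

theorem continuous_nextNode {n : ℕ} [NeZero n] (j : Fin n) :
    Continuous fun x : Fin n → ℝ => nextNode x j := by
  unfold nextNode; fun_prop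

theorem continuous_regArcMax {n : ℕ} [NeZero n] {ν : Fin n → ℝ} (hν : ∀ j, 0 < ν j)
    {K w : ℝ → ℝ} (hK : Continuous (expKernel K)) {C : ℝ} (hw : ∀ t, |w t| ≤ C) (j : Fin n) :
    Continuous fun p : ℝ × (Fin n → ℝ) => regArcMax ν K w j p.1 p.2 := by
  refine continuous_weightedSup hw (g := fun p : ℝ × (Fin n → ℝ) => fun t =>
    regProd ν K p.1 p.2 (max (p.2 j) (min t (nextNode p.2 j)))) ?_
  have h : Continuous fun p : (ℝ × (Fin n → ℝ)) × ℝ =>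
      max (p.1.2 j) (min p.2 (nextNode p.1.2 j)) := by
    have := (continuous_nextNode j).comp
      (continuous_snd.comp (continuous_fst (X := ℝ × (Fin n → ℝ)) (Y := ℝ)))
    exact Continuous.max (by fun_prop) (Continuous.min continuous_snd this)
  exact (continuous_regProd hν hK).comp (continuous_fst.prodMk h)

theorem continuous_regProd_right {n : ℕ} {ν : Fin n → ℝ} (hν : ∀ j, 0 < ν j) {K : ℝ → ℝ}
    (hK : Continuous (expKernel K)) (ε : ℝ) (x : Fin n → ℝ) : Continuous (regProd ν K ε x) :=
  (continuous_regProd hν hK).comp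
    (g := fun p : (ℝ × (Fin n → ℝ)) × ℝ => regProd ν K p.1.1 p.1.2 p.2)
    (f := fun t : ℝ => ((ε, x), t)) (by fun_prop)

/-! ### Global and arc suprema on the line. -/

/-- A point of the line is an integer translate of a point of any given unit interval. -/
theorem exists_int_add_mem_Ico (t c : ℝ) : ∃ m : ℤ, t + m ∈ Ico c (c + 1) := by
  refine ⟨-⌊t - c⌋, ?_⟩
  have h1 := Int.floor_le (t - c)
  have h2 := Int.lt_floor_add_one (t - c)
  push_cast
  constructor <;> linarith

theorem le_regMax {n : ℕ} {ν : Fin n → ℝ} (hν : ∀ j, 0 < ν j) {K w : ℝ → ℝ}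
    (hK : Continuous (expKernel K)) {C : ℝ} (hw : ∀ t, |w t| ≤ C)
    (hwp : ∀ t (m : ℤ), w (t + m) = w t) (ε : ℝ) (x : Fin n → ℝ) (t : ℝ) :
    w t * regProd ν K ε x t ≤ regMax ν K w ε x := by
  obtain ⟨m, hm⟩ := exists_int_add_mem_Ico t 0
  rw [← hwp t m, ← regProd_add_int ν K ε x t m]
  exact le_weightedSup hw (continuous_regProd_right hν hK ε x)
    ⟨by linarith [hm.1], by linarith [hm.2]⟩

theorem le_regArcMax {n : ℕ} [NeZero n] {ν : Fin n → ℝ} (hν : ∀ j, 0 < ν j) {K w : ℝ → ℝ}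
    (hK : Continuous (expKernel K)) {C : ℝ} (hw : ∀ t, |w t| ≤ C) (ε : ℝ) {x : Fin n → ℝ}
    {j : Fin n} {t : ℝ} (ht : t ∈ Icc (-1 : ℝ) 3) (htx : t ∈ Icc (x j) (nextNode x j)) :
    w t * regProd ν K ε x t ≤ regArcMax ν K w j ε x := by
  have h := le_weightedSup (f := fun t => regProd ν K ε x (max (x j) (min t (nextNode x j)))) hw
    ((continuous_regProd_right hν hK ε x).comp (by fun_prop)) ht
  simp only [min_eq_left htx.2, max_eq_right htx.1] at h
  exact h

theorem nextNode_sub (n : ℕ) [NeZero n] (x : Fin n → ℝ) (j : Fin n) :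
    ∃ m : ℤ, nextNode x j - x (j + 1) = m :=
  ⟨if j + 1 = 0 then 1 else 0, by unfold nextNode; split_ifs <;> simp⟩

/-- Points outside the open arc are clamped to an end node, where the product vanishes; `0 ≤ B`
covers them. In particular a degenerate arc has supremum at most `0`. -/
theorem regArcMax_le {n : ℕ} [NeZero n] {ν : Fin n → ℝ} (hν : ∀ j, 0 < ν j) {K w : ℝ → ℝ}
    (ε : ℝ) {x : Fin n → ℝ} {j : Fin n} (hx : x j ≤ nextNode x j) {B : ℝ} (hB : 0 ≤ B)
    (h : ∀ t ∈ Ioo (x j) (nextNode x j), w t * regProd ν K ε x t ≤ B) :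
    regArcMax ν K w j ε x ≤ B := by
  refine weightedSup_le fun t _ => ?_
  obtain ⟨m, hm⟩ := nextNode_sub n x j
  rcases le_or_gt t (x j) with h1 | h1
  · rw [max_eq_left (min_le_iff.2 (Or.inl h1)), regProd_eq_zero hν K ε (j := j) (m := 0) (by simp),
      mul_zero]
    exact hB
  rcases le_or_gt (nextNode x j) t with h2 | h2
  · rw [min_eq_right h2, max_eq_right hx, regProd_eq_zero hν K ε hm, mul_zero]
    exact hB
  · rw [min_eq_left h2.le, max_eq_right h1.le]
    exact h t ⟨h1, h2⟩

/-! ### The effect of widening an arc on the complementary arc. -/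

/-- Spreading two points of `(0,1)` apart: the exponential form of the decrease of secant slopes of
the strictly concave function `K + ε s (1 - s)`. -/
theorem regKernel_spread {K : ℝ → ℝ} (hconc : ConcaveOn ℝ (Ioo 0 1) K) {ε u v δ₁ δ₂ : ℝ}
    (hε : 0 ≤ ε) (hu : 0 < u - δ₁) (hδ₁ : 0 < δ₁) (huv : u ≤ v) (hδ₂ : 0 < δ₂) (hv : v + δ₂ < 1) :
    ∃ σ : ℝ, regKernel K ε (u - δ₁) ≤ regKernel K ε u * Real.exp (-(σ * δ₁)) ∧
      regKernel K ε (v + δ₂) ≤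
        regKernel K ε v * Real.exp (σ * δ₂ - ε * (δ₁ + δ₂) * δ₂) := by
  have m1 : u - δ₁ ∈ Ioo (0 : ℝ) 1 := ⟨hu, by linarith⟩
  have m2 : u ∈ Ioo (0 : ℝ) 1 := ⟨by linarith, by linarith⟩
  have m3 : v ∈ Ioo (0 : ℝ) 1 := ⟨by linarith, by linarith⟩
  have m4 : v + δ₂ ∈ Ioo (0 : ℝ) 1 := ⟨by linarith, by linarith⟩
  have key : (K (v + δ₂) - K v) / δ₂ ≤ (K u - K (u - δ₁)) / δ₁ := by
    rcases huv.eq_or_lt with rfl | huv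
    · simpa using hconc.slope_anti_adjacent m1 m4 (by linarith : u - δ₁ < u) (by linarith)
    · have h1 := hconc.slope_anti_adjacent m1 m3 (by linarith : u - δ₁ < u) huv
      have h2 := hconc.slope_anti_adjacent m2 m4 huv (by linarith : v < v + δ₂)
      simp only [sub_sub_cancel, add_sub_cancel_left] at h1 h2
      exact h2.trans h1
  set s := (K u - K (u - δ₁)) / δ₁ with hs
  have hs1 : s * δ₁ = K u - K (u - δ₁) := by rw [hs]; field_simp
  have hs2 : K (v + δ₂) - K v ≤ s * δ₂ := (div_le_iff₀ hδ₂).1 key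
  -- This is the secant slope of `K + ε s(1 - s)` on `[u - δ₁, u]`. The quadratic part has slope `1
  -- - 2v - δ₂` on `[v, v + δ₂]`, lower by at least `δ₁ + δ₂`.
  refine ⟨s + ε * (1 - 2 * u + δ₁), ?_, ?_⟩
  · rw [regKernel_of_mem m1, regKernel_of_mem m2, ← Real.exp_add, Real.exp_le_exp]
    linear_combination hs1
  · rw [regKernel_of_mem m3, regKernel_of_mem m4, ← Real.exp_add, Real.exp_le_exp]
    have : 0 ≤ ε * δ₂ * (v - u) := by
      have := sub_nonneg.2 huv
      positivity
    nlinarith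

/-- The direction in which the nodes of `B` move forward and those of `A` move backward, the weighted
centre of all nodes being preserved. -/
def spreadDir {n : ℕ} (ν : Fin n → ℝ) (A B : Finset (Fin n)) (i : Fin n) : ℝ :=
  (if i ∈ B then (∑ k ∈ B, ν k)⁻¹ else 0) - if i ∈ A then (∑ k ∈ A, ν k)⁻¹ else 0

theorem sum_pos_of_mem {n : ℕ} {ν : Fin n → ℝ} (hν : ∀ j, 0 < ν j) {A : Finset (Fin n)}
    {i : Fin n} (hi : i ∈ A) : 0 < ∑ k ∈ A, ν k :=
  Finset.sum_pos (fun k _ => hν k) ⟨i, hi⟩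

theorem spreadDir_of_mem_left {n : ℕ} (ν : Fin n → ℝ) {A B : Finset (Fin n)} (hAB : Disjoint A B)
    {i : Fin n} (hi : i ∈ A) : spreadDir ν A B i = -(∑ k ∈ A, ν k)⁻¹ := by
  simp [spreadDir, hi, Finset.disjoint_left.1 hAB hi]

theorem spreadDir_of_mem_right {n : ℕ} (ν : Fin n → ℝ) {A B : Finset (Fin n)} (hAB : Disjoint A B)
    {i : Fin n} (hi : i ∈ B) : spreadDir ν A B i = (∑ k ∈ B, ν k)⁻¹ := by
  simp [spreadDir, hi, Finset.disjoint_right.1 hAB hi]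

theorem sum_mul_spreadDir {n : ℕ} {ν : Fin n → ℝ} (hν : ∀ j, 0 < ν j) {A B : Finset (Fin n)}
    {iA iB : Fin n} (hiA : iA ∈ A) (hiB : iB ∈ B) : ∑ i, ν i * spreadDir ν A B i = 0 := by
  have h : ∀ S : Finset (Fin n), ∀ k ∈ S,
      ∑ i, ν i * (if i ∈ S then (∑ k ∈ S, ν k)⁻¹ else 0) = 1 := by
    intro S k hk
    simp only [mul_ite, mul_zero, Finset.sum_ite_mem, Finset.univ_inter, ← Finset.sum_mul]
    exact mul_inv_cancel₀ (sum_pos_of_mem hν hk).ne'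
  simp only [spreadDir, mul_sub, Finset.sum_sub_distrib]
  rw [h A _ hiA, h B _ hiB, sub_self]

theorem regProd_le_of_forall {n : ℕ} {ν : Fin n → ℝ} (hν : ∀ j, 0 < ν j) {K : ℝ → ℝ} {ε t : ℝ}
    {x x' s : Fin n → ℝ}
    (h : ∀ i, regKernel K ε (t - x' i) ≤ regKernel K ε (t - x i) * Real.exp (s i)) :
    regProd ν K ε x' t ≤ Real.exp (∑ i, ν i * s i) * regProd ν K ε x t := by
  rw [Real.exp_sum, regProd, regProd, ← Finset.prod_mul_distrib]
  refine Finset.prod_le_prod (fun i _ => Real.rpow_nonneg (regKernel_nonneg _ _ _) _) fun i _ => ?_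
  refine (Real.rpow_le_rpow (regKernel_nonneg _ _ _) (h i) (hν i).le).trans_eq ?_
  rw [Real.mul_rpow (regKernel_nonneg _ _ _) (Real.exp_pos _).le, ← Real.exp_mul, mul_comm,
    mul_comm (s i)]

/-- Moving nodes at `b` forward and nodes at `a` backward decreases the product between them by a
fixed factor. -/
theorem regProd_spread_le {n : ℕ} {ν : Fin n → ℝ} (hν : ∀ j, 0 < ν j) {K : ℝ → ℝ}
    (hconc : ConcaveOn ℝ (Ioo 0 1) K) {ε : ℝ} (hε : 0 ≤ ε) {x : Fin n → ℝ} {a b h : ℝ}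
    (hab : a ≤ b + 1) (hh : 0 < h) {A B : Finset (Fin n)}
    (hA : ∀ i ∈ A, ∃ m : ℤ, x i = a + m) (hB : ∀ i ∈ B, ∃ m : ℤ, x i = b + m)
    (hAB : Disjoint A B) {iA iB : Fin n} (hiA : iA ∈ A) (hiB : iB ∈ B) {t : ℝ}
    (ht : t ∈ Icc (b + h * (∑ k ∈ B, ν k)⁻¹) (a - h * (∑ k ∈ A, ν k)⁻¹)) :
    regProd ν K ε (x + h • spreadDir ν A B) t ≤
      Real.exp (-(ε * (h * (∑ k ∈ B, ν k)⁻¹ + h * (∑ k ∈ A, ν k)⁻¹) * h)) *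
        regProd ν K ε x t := by
  have hνA := sum_pos_of_mem hν hiA
  have hνB := sum_pos_of_mem hν hiB
  set cA := (∑ k ∈ A, ν k)⁻¹ with hcA
  set cB := (∑ k ∈ B, ν k)⁻¹ with hcB
  have hcA0 : 0 < cA := inv_pos.2 hνA
  have hcB0 : 0 < cB := inv_pos.2 hνB
  have dA : ∀ i ∈ A, spreadDir ν A B i = -cA := fun i hi => spreadDir_of_mem_left ν hAB hi
  have dB : ∀ i ∈ B, spreadDir ν A B i = cB := fun i hi => spreadDir_of_mem_right ν hAB hi
  have hnn : 0 ≤ Real.exp (-(ε * (h * cB + h * cA) * h)) * regProd ν K ε x t :=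
    mul_nonneg (Real.exp_pos _).le (regProd_nonneg _ _ _ _ _)
  -- At either end of the interval a moved node sits at `t` modulo `1`, so the left side is `0`; the
  -- kernel bounds need arguments strictly inside `(0,1)`.
  rcases ht.1.eq_or_lt with hb | hb
  · obtain ⟨m, hm⟩ := hB iB hiB
    rw [regProd_eq_zero hν K ε (j := iB) (m := -m)]
    · exact hnn
    · simp [dB iB hiB, hm, ← hb]
  rcases ht.2.eq_or_lt with ha | ha
  · obtain ⟨m, hm⟩ := hA iA hiA
    rw [regProd_eq_zero hν K ε (j := iA) (m := -m)]
    · exact hnn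
    · simp [dA iA hiA, hm, ha]; ring
  have hhA : 0 < h * cA := by positivity
  have hhB : 0 < h * cB := by positivity
  -- Since `t` lies below `a`, periodicity replaces `t - a` by `t - a + 1`. Then `u ≤ v` is exactly
  -- `a ≤ b + 1`.
  obtain ⟨σ, h1, h2⟩ := regKernel_spread hconc hε (u := t - b) (v := t - a + 1) (δ₁ := h * cB)
    (δ₂ := h * cA) (by linarith) hhB (by linarith) hhA (by linarith)
  set τ := ε * (h * cB + h * cA) with hτ
  -- The `σ` terms cancel in the weighted sum, because the direction preserves the weighted centre.
  -- The nodes of `A` leave the gain `τ * h`, as `cA` normalizes their total weight to `1`.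
  refine (regProd_le_of_forall hν (x := x) (s := fun i => -(σ * h) * spreadDir ν A B i -
    τ * h * if i ∈ A then cA else 0) fun i => ?_).trans_eq ?_
  · by_cases hiA' : i ∈ A
    · obtain ⟨m, hm⟩ := hA i hiA'
      have e1 : t - (x + h • spreadDir ν A B) i = t - a + 1 + h * cA + (-m - 1 : ℤ) := by
        simp [dA i hiA', hm]; ring
      have e2 : t - x i = t - a + 1 + (-m - 1 : ℤ) := by simp [hm]; ring
      rw [e1, e2, regKernel_add_int, regKernel_add_int, dA i hiA', if_pos hiA']
      convert h2 using 3
      ring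
    · by_cases hiB' : i ∈ B
      · obtain ⟨m, hm⟩ := hB i hiB'
        have e1 : t - (x + h • spreadDir ν A B) i = t - b - h * cB + (-m : ℤ) := by
          simp [dB i hiB', hm]; ring
        have e2 : t - x i = t - b + (-m : ℤ) := by simp [hm]; ring
        rw [e1, e2, regKernel_add_int, regKernel_add_int, dB i hiB', if_neg hiA']
        convert h1 using 3
        ring
      · have : spreadDir ν A B i = 0 := by simp [spreadDir, hiA', hiB']
        simp [this, hiA']
  · have e : ∑ i, ν i * (-(σ * h) * spreadDir ν A B i - τ * h * if i ∈ A then cA else 0)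
        = -(σ * h) * ∑ i, ν i * spreadDir ν A B i
          - τ * h * ∑ i, ν i * if i ∈ A then cA else 0 := by
      rw [Finset.mul_sum, Finset.mul_sum, ← Finset.sum_sub_distrib]
      exact Finset.sum_congr rfl fun i _ => by ring
    have e' : ∑ i, ν i * (if i ∈ A then cA else 0) = 1 := by
      simp only [mul_ite, mul_zero, Finset.sum_ite_mem, Finset.univ_inter, ← Finset.sum_mul]
      exact mul_inv_cancel₀ hνA.ne'
    rw [e, e', sum_mul_spreadDir hν hiA hiB]
    simp

/-! ### Cyclic order of the nodes and admissible perturbations. -/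

theorem add_one_cases {n : ℕ} [NeZero n] (j : Fin n) :
    (j + 1 = 0 ∧ ∀ i, i ≤ j) ∨ (j + 1 ≠ 0 ∧ j < j + 1 ∧ ∀ i, j < i → j + 1 ≤ i) := by
  have hv : (j + 1 : Fin n).val = (j.val + 1) % n := by
    rw [Fin.val_add, Fin.val_one', Nat.add_mod_mod]
  have hj := j.isLt
  rcases (Nat.succ_le_of_lt hj).eq_or_lt with h | h
  · left
    refine ⟨Fin.ext ?_, fun i => Fin.le_def.2 ?_⟩
    · rw [hv, show j.val + 1 = n from h, Nat.mod_self]; rfl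
    · have := i.isLt
      omega
  · right
    rw [Nat.mod_eq_of_lt h] at hv
    refine ⟨fun h0 => ?_, Fin.lt_def.2 (by omega), fun i hi => Fin.le_def.2 ?_⟩
    · rw [h0] at hv
      simp at hv
    · have := Fin.lt_def.1 hi
      omega

theorem le_nextNode {n : ℕ} [NeZero n] {x : Fin n → ℝ} (hx : x ∈ liftedSimplex n) (j : Fin n) :
    x j ≤ nextNode x j := by
  unfold nextNode
  rcases add_one_cases j with h | h
  · rw [if_pos h.1]; exact hx.2 _ _
  · rw [if_neg h.1, add_zero]; exact hx.1 h.2.1.le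

theorem nextNode_le {n : ℕ} [NeZero n] {x : Fin n → ℝ} (hx : x ∈ liftedSimplex n) (j : Fin n) :
    nextNode x j ≤ x j + 1 := by
  unfold nextNode
  rcases add_one_cases j with h | h
  · rw [if_pos h.1, h.1]; gcongr; exact hx.1 (Fin.zero_le _)
  · rw [if_neg h.1, add_zero]; exact hx.2 _ _

/-- The nodes lifted so that they follow the `j`-th arc. -/
def liftAfter {n : ℕ} (x : Fin n → ℝ) (j i : Fin n) : ℝ := x i + if i ≤ j then 1 else 0

theorem liftAfter_mem {n : ℕ} [NeZero n] {x : Fin n → ℝ} (hx : x ∈ liftedSimplex n)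
    (j i : Fin n) : liftAfter x j i ∈ Icc (nextNode x j) (x j + 1) := by
  unfold liftAfter nextNode
  rcases le_or_gt i j with hij | hij
  · rw [if_pos hij]
    refine ⟨?_, by gcongr; exact hx.1 hij⟩
    rcases add_one_cases j with h | h
    · rw [if_pos h.1, h.1]; gcongr; exact hx.1 (Fin.zero_le _)
    · rw [if_neg h.1, add_zero]; exact hx.2 _ _
  · rw [if_neg hij.not_ge, add_zero]
    refine ⟨?_, hx.2 _ _⟩
    rcases add_one_cases j with h | h
    · exact absurd (h.2 i) hij.not_ge
    · rw [if_neg h.1, add_zero]; exact hx.1 (h.2.2 i hij)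

theorem liftAfter_succ {n : ℕ} [NeZero n] (x : Fin n → ℝ) (j : Fin n) :
    liftAfter x j (j + 1) = nextNode x j := by
  unfold liftAfter nextNode
  rcases add_one_cases j with h | h
  · rw [if_pos h.1, if_pos (h.2 _)]
  · rw [if_neg h.1, if_neg h.2.1.not_ge]

/-- The lifted simplex in terms of the nodes following the `j`-th arc. -/
theorem mem_liftedSimplex_of_liftAfter {n : ℕ} {x x' : Fin n → ℝ} (hx : x ∈ liftedSimplex n)
    {j : Fin n}
    (h : ∀ i k, liftAfter x j i ≤ liftAfter x j k → liftAfter x' j i ≤ liftAfter x' j k)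
    (h' : ∀ i k, liftAfter x' j k ≤ liftAfter x' j i + 1) : x' ∈ liftedSimplex n := by
  have key : ∀ i k, i ≤ k → x' i ≤ x' k ∧ x' k ≤ x' i + 1 := by
    intro i k hik
    have h1 := h i k
    have h2 := h k i
    have h3 := h' i k
    have h4 := h' k i
    have h5 := hx.1 hik
    have h6 := hx.2 i k
    unfold liftAfter at h1 h2 h3 h4
    rcases le_or_gt k j with hk | hk
    · rw [if_pos hk, if_pos (hik.trans hk)] at *
      constructor <;> [linarith [h1 (by linarith)]; linarith]
    -- For a pair straddling `j` the lift shifts only `i` by a turn, so the two hypotheses swap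
    -- roles: the length bound gives the order and the order gives the length bound.
    · rcases le_or_gt i j with hi | hi
      · rw [if_neg hk.not_ge, if_pos hi] at *
        constructor <;> [linarith; linarith [h2 (by linarith)]]
      · rw [if_neg hk.not_ge, if_neg hi.not_ge] at *
        constructor <;> [linarith [h1 (by linarith)]; linarith]
  refine ⟨fun i k hik => (key i k hik).1, fun i k => ?_⟩
  rcases le_total i k with hik | hik
  · exact (key i k hik).2
  · linarith [(key k i hik).1]

theorem liftAfter_add {n : ℕ} (x d : Fin n → ℝ) (h : ℝ) (j i : Fin n) :
    liftAfter (x + h • d) j i = liftAfter x j i + h * d i := by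
  simp only [liftAfter, Pi.add_apply, Pi.smul_apply, smul_eq_mul]; ring

/-- Small perturbations along a direction compatible with coincidences stay in the simplex. -/
theorem eventually_mem_liftedSimplex {n : ℕ} [NeZero n] {x d : Fin n → ℝ}
    (hx : x ∈ liftedSimplex n) (j : Fin n)
    (hd : ∀ i k, liftAfter x j i = liftAfter x j k → d i = d k)
    (hb : ∀ i, liftAfter x j i = nextNode x j → 0 ≤ d i)
    (ha : ∀ i, liftAfter x j i = x j + 1 → d i ≤ 0) :
    ∀ᶠ h in 𝓝[>] (0 : ℝ), x + h • d ∈ liftedSimplex n := by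
  have lt_ev : ∀ p q c e : ℝ, p < q → ∀ᶠ h in 𝓝[>] (0 : ℝ), p + h * c ≤ q + h * e := by
    intro p q c e hpq
    have h1 : Tendsto (fun h : ℝ => p + h * c) (𝓝 0) (𝓝 (p + 0 * c)) :=
      Continuous.tendsto (by fun_prop) 0
    have h2 : Tendsto (fun h : ℝ => q + h * e) (𝓝 0) (𝓝 (q + 0 * e)) :=
      Continuous.tendsto (by fun_prop) 0
    exact nhdsWithin_le_nhds ((h1.eventually_lt h2 (by simpa using hpq)).mono fun _ => le_of_lt)
  have e1 : ∀ᶠ h in 𝓝[>] (0 : ℝ), ∀ i k, liftAfter x j i ≤ liftAfter x j k →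
      liftAfter (x + h • d) j i ≤ liftAfter (x + h • d) j k := by
    refine eventually_all.2 fun i => eventually_all.2 fun k => ?_
    simp only [liftAfter_add]
    rcases lt_trichotomy (liftAfter x j i) (liftAfter x j k) with h | h | h
    · exact (lt_ev _ _ _ _ h).mono fun _ H _ => H
    · exact Eventually.of_forall fun _ _ => by rw [h, hd i k h]
    · exact Eventually.of_forall fun _ H => absurd H h.not_ge
  have e2 : ∀ᶠ h in 𝓝[>] (0 : ℝ), ∀ i, nextNode x j ≤ liftAfter (x + h • d) j i := by
    refine eventually_all.2 fun i => ?_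
    simp only [liftAfter_add]
    rcases (liftAfter_mem hx j i).1.eq_or_lt with h | h
    · filter_upwards [self_mem_nhdsWithin] with t ht
      have := mul_nonneg (le_of_lt ht) (hb i h.symm)
      linarith
    · simpa using lt_ev _ _ 0 (d i) h
  have e3 : ∀ᶠ h in 𝓝[>] (0 : ℝ), ∀ i, liftAfter (x + h • d) j i ≤ x j + 1 := by
    refine eventually_all.2 fun i => ?_
    simp only [liftAfter_add]
    rcases (liftAfter_mem hx j i).2.eq_or_lt with h | h
    · filter_upwards [self_mem_nhdsWithin] with t ht
      have := mul_nonpos_of_nonneg_of_nonpos (le_of_lt ht) (ha i h)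
      linarith
    · simpa using lt_ev _ _ (d i) 0 h
  filter_upwards [e1, e2, e3] with h h1 h2 h3
  refine mem_liftedSimplex_of_liftAfter hx h1 fun i k => ?_
  linarith [h2 i, h3 k, le_nextNode hx j]

/-! ### Existence of minimizers, their equioscillation, and the limit `ε → 0`. -/

theorem isCompact_liftedSimplex_inter (n : ℕ) [NeZero n] :
    IsCompact (liftedSimplex n ∩ {x | x 0 ∈ Icc (0 : ℝ) 1}) := by
  have hK : IsCompact (Icc (0 : Fin n → ℝ) fun _ => 2) := isCompact_Icc
  refine hK.of_isClosed_subset (IsClosed.inter ?_ ?_) ?_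
  · refine IsClosed.and ?_ ?_
    · simp only [Monotone, ofPred_forall]
      exact isClosed_iInter fun i => isClosed_iInter fun j => isClosed_iInter fun _ =>
        isClosed_le (by fun_prop) (by fun_prop)
    · simp only [ofPred_forall]
      exact isClosed_iInter fun i => isClosed_iInter fun j =>
        isClosed_le (by fun_prop) (by fun_prop)
  · exact isClosed_Icc.preimage (continuous_apply 0)
  · rintro x ⟨hx, h0, h1⟩
    exact ⟨fun i => h0.trans (hx.1 (Fin.zero_le i)), fun i => (hx.2 0 i).trans (by linarith)⟩

theorem add_int_mem_liftedSimplex {n : ℕ} {x : Fin n → ℝ} (hx : x ∈ liftedSimplex n) (m : ℤ) :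
    (fun i => x i + m) ∈ liftedSimplex n :=
  ⟨fun i k hik => by simpa using hx.1 hik, fun i k => by linarith [hx.2 i k]⟩

theorem regMax_add_int {n : ℕ} (ν : Fin n → ℝ) (K w : ℝ → ℝ) (ε : ℝ) (x : Fin n → ℝ) (m : ℤ) :
    regMax ν K w ε (fun i => x i + m) = regMax ν K w ε x := by
  unfold regMax
  congr 1
  funext t
  refine Finset.prod_congr rfl fun j _ => ?_
  rw [show t - (x j + m) = t - x j + (-m : ℤ) by push_cast; ring, regKernel_add_int]

theorem exists_minimal_regMax {n : ℕ} [NeZero n] {ν : Fin n → ℝ} (hν : ∀ j, 0 < ν j)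
    {K w : ℝ → ℝ} (hK : Continuous (expKernel K)) {C : ℝ} (hw : ∀ t, |w t| ≤ C) (ε : ℝ) :
    ∃ x ∈ liftedSimplex n ∩ {x | x 0 ∈ Icc (0 : ℝ) 1},
      ∀ x' ∈ liftedSimplex n, regMax ν K w ε x ≤ regMax ν K w ε x' := by
  have hc : Continuous fun x : Fin n → ℝ => regMax ν K w ε x :=
    (continuous_regMax hν hK hw).comp (g := fun p : ℝ × (Fin n → ℝ) => regMax ν K w p.1 p.2)
      (f := fun x => (ε, x)) (by fun_prop)
  obtain ⟨x, hx, hmin⟩ := (isCompact_liftedSimplex_inter n).exists_isMinOn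
    ⟨0, ⟨fun _ _ _ => le_rfl, fun _ _ => by simp⟩, by simp⟩ hc.continuousOn
  refine ⟨x, hx, fun x' hx' => ?_⟩
  obtain ⟨m, hm⟩ := exists_int_add_mem_Ico (x' 0) 0
  rw [← regMax_add_int ν K w ε x' m]
  exact hmin ⟨add_int_mem_liftedSimplex hx' m, hm.1, by linarith [hm.2]⟩

/-- For the strictly concave regularization, every minimax point is an equioscillation point. -/
theorem regArcMax_eq_of_minimal {n : ℕ} [NeZero n] {ν : Fin n → ℝ} (hν : ∀ j, 0 < ν j)
    {K w : ℝ → ℝ} (hconc : ConcaveOn ℝ (Ioo 0 1) K) (hK : Continuous (expKernel K)) {C : ℝ}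
    (hw0 : ∀ t, 0 ≤ w t) (hw : ∀ t, |w t| ≤ C) (hwp : ∀ t (m : ℤ), w (t + m) = w t)
    {ε : ℝ} (hε : 0 < ε) {x : Fin n → ℝ} (hx : x ∈ liftedSimplex n) (hx0 : x 0 ∈ Icc (0 : ℝ) 1)
    (hmin : ∀ x' ∈ liftedSimplex n, regMax ν K w ε x ≤ regMax ν K w ε x') (j : Fin n) :
    regArcMax ν K w j ε x = regMax ν K w ε x := by
  have hle := le_regMax hν hK hw hwp ε
  have hnn : 0 ≤ regMax ν K w ε x := (mul_nonneg (hw0 0) (regProd_nonneg _ _ _ _ _)).trans (hle x 0)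
  refine le_antisymm (regArcMax_le hν ε (le_nextNode hx j) hnn fun t _ => hle x t) ?_
  by_contra! hlt
  have hxj0 : 0 ≤ x j := hx0.1.trans (hx.1 (Fin.zero_le j))
  have hxj2 : x j + 1 ≤ 3 := by linarith [hx.2 0 j, hx0.2]
  have hb2 : nextNode x j ≤ 2 := by
    unfold nextNode
    rcases add_one_cases j with h | h
    · rw [if_pos h.1, h.1]; linarith [hx0.2]
    · rw [if_neg h.1, add_zero]; linarith [hx.2 0 (j + 1), hx0.2]
  -- An arc making a full turn carries the global supremum, against `hlt`. Otherwise its two ends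
  -- are distinct on the circle, so `A` and `B` below are disjoint.
  rcases (nextNode_le hx j).eq_or_lt with hab | hab
  · refine hlt.not_ge (weightedSup_le fun t _ => ?_)
    obtain ⟨m, hm⟩ := exists_int_add_mem_Ico t (x j)
    rw [← hwp t m, ← regProd_add_int ν K ε x t m]
    exact le_regArcMax hν hK hw ε ⟨by linarith [hm.1], by linarith [hm.2]⟩
      ⟨hm.1, hab ▸ hm.2.le⟩
  let A : Finset (Fin n) := Finset.univ.filter fun i => liftAfter x j i = x j + 1
  let B : Finset (Fin n) := Finset.univ.filter fun i => liftAfter x j i = nextNode x j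
  have memA : ∀ i, i ∈ A ↔ liftAfter x j i = x j + 1 := fun i => by simp [A]
  have memB : ∀ i, i ∈ B ↔ liftAfter x j i = nextNode x j := fun i => by simp [B]
  have hjA : j ∈ A := by simp [memA, liftAfter]
  have hjB : j + 1 ∈ B := (memB _).2 (liftAfter_succ x j)
  have hAB : Disjoint A B := Finset.disjoint_left.2 fun i hi hi' => by
    rw [memA] at hi
    rw [memB] at hi'
    linarith
  have hcA : 0 < (∑ k ∈ A, ν k)⁻¹ := inv_pos.2 (sum_pos_of_mem hν hjA)
  have hcB : 0 < (∑ k ∈ B, ν k)⁻¹ := inv_pos.2 (sum_pos_of_mem hν hjB)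
  set d := spreadDir ν A B with hd
  have dj : d j = -(∑ k ∈ A, ν k)⁻¹ := spreadDir_of_mem_left ν hAB hjA
  have dj' : d (j + 1) = (∑ k ∈ B, ν k)⁻¹ := spreadDir_of_mem_right ν hAB hjB
  have ev1 : ∀ᶠ h in 𝓝[>] (0 : ℝ), x + h • d ∈ liftedSimplex n := by
    refine eventually_mem_liftedSimplex hx j (fun i k hik => ?_) (fun i hi => ?_) fun i hi => ?_
    · simp only [hd, spreadDir, memA, memB, hik]
    · rw [hd, spreadDir_of_mem_right ν hAB ((memB i).2 hi)]; exact hcB.le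
    · rw [hd, spreadDir_of_mem_left ν hAB ((memA i).2 hi)]; linarith
  have ev2 : ∀ᶠ h in 𝓝[>] (0 : ℝ), regArcMax ν K w j ε (x + h • d) < regMax ν K w ε x := by
    have hc : Continuous fun h : ℝ => regArcMax ν K w j ε (x + h • d) :=
      (continuous_regArcMax hν hK hw j).comp
        (g := fun p : ℝ × (Fin n → ℝ) => regArcMax ν K w j p.1 p.2)
        (f := fun h : ℝ => (ε, x + h • d)) (by fun_prop)
    exact nhdsWithin_le_nhds ((hc.tendsto 0).eventually_lt_const (by simpa using hlt))
  -- The arc lies in `[0, 2]`; shifts below `1` keep the widened arc in the window `[-1, 3]`.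
  have ev3 : ∀ c : ℝ, ∀ᶠ h in 𝓝[>] (0 : ℝ), h * c < 1 := fun c =>
    nhdsWithin_le_nhds ((Continuous.tendsto (by fun_prop : Continuous fun h : ℝ => h * c)
      0).eventually_lt_const (by simp))
  obtain ⟨h, hmem, harc, hA1, hB1, hpos⟩ := (ev1.and (ev2.and ((ev3 (∑ k ∈ A, ν k)⁻¹).and
    ((ev3 (∑ k ∈ B, ν k)⁻¹).and self_mem_nhdsWithin)))).exists
  have hpos : 0 < h := hpos
  set δA := h * (∑ k ∈ A, ν k)⁻¹ with hδA
  set δB := h * (∑ k ∈ B, ν k)⁻¹ with hδB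
  have hδA0 : 0 < δA := by positivity
  have hδB0 : 0 < δB := by positivity
  have hxj' : (x + h • d) j = x j - δA := by simp [dj, hδA, sub_eq_add_neg]
  have hnext' : nextNode (x + h • d) j = nextNode x j + δB := by
    simp only [nextNode, Pi.add_apply, Pi.smul_apply, smul_eq_mul, dj', hδB]; ring
  -- Positivity turns the factor `ρ < 1` into a strict decrease.
  have hVpos : 0 < regMax ν K w ε x := by
    refine lt_of_le_of_lt ?_ hlt
    have hxjw : x j ∈ Icc (-1 : ℝ) 3 := ⟨by linarith, by linarith⟩
    exact (mul_nonneg (hw0 _) (regProd_nonneg _ _ _ _ _)).trans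
      (le_regArcMax hν hK hw ε hxjw ⟨le_rfl, le_nextNode hx j⟩)
  set ρ := Real.exp (-(ε * (δB + δA) * h)) with hρ
  have hρ1 : ρ < 1 := by
    rw [hρ, Real.exp_lt_one_iff]
    have : 0 < ε * (δB + δA) * h := by positivity
    linarith
  refine (hmin _ hmem).not_gt ((weightedSup_le (B := max (regArcMax ν K w j ε (x + h • d))
    (ρ * regMax ν K w ε x)) fun t _ => ?_).trans_lt (max_lt harc (by nlinarith)))
  -- One turn starting at the moved `j`-th node consists of the widened arc followed by its
  -- complement.
  obtain ⟨m, hm⟩ := exists_int_add_mem_Ico t (x j - δA)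
  rw [← hwp t m, ← regProd_add_int ν K ε _ t m]
  rcases le_total (t + m) (nextNode x j + δB) with ht | ht
  · refine le_max_of_le_left (le_regArcMax hν hK hw ε ⟨by linarith [hm.1], by linarith⟩ ?_)
    rw [hxj', hnext']
    exact ⟨hm.1, ht⟩
  · refine le_max_of_le_right ?_
    have hsp := regProd_spread_le hν hconc hε.le (x := x) (a := x j + 1) (b := nextNode x j)
      (h := h) (A := A) (B := B) (iA := j) (iB := j + 1) (t := t + m)
      (by linarith [le_nextNode hx j]) hpos
      (fun i hi => ⟨-if i ≤ j then 1 else 0, by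
        rw [← (memA i).1 hi, liftAfter]; split_ifs <;> simp⟩)
      (fun i hi => ⟨-if i ≤ j then 1 else 0, by
        rw [← (memB i).1 hi, liftAfter]; split_ifs <;> simp⟩)
      hAB hjA hjB ⟨ht, by linarith [hm.2]⟩
    calc w (t + m) * regProd ν K ε (x + h • d) (t + m)
        ≤ w (t + m) * (ρ * regProd ν K ε x (t + m)) := mul_le_mul_of_nonneg_left hsp (hw0 _)
      _ = ρ * (w (t + m) * regProd ν K ε x (t + m)) := by ring
      _ ≤ ρ * regMax ν K w ε x := mul_le_mul_of_nonneg_left (hle x _) (Real.exp_pos _).le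

/-- Existence of a minimax point which is an equioscillation point, without strict concavity. -/
theorem exists_minimal_equioscillating {n : ℕ} [NeZero n] {ν : Fin n → ℝ} (hν : ∀ j, 0 < ν j)
    {K w : ℝ → ℝ} (hconc : ConcaveOn ℝ (Ioo 0 1) K) (hK : Continuous (expKernel K)) {C : ℝ}
    (hw0 : ∀ t, 0 ≤ w t) (hw : ∀ t, |w t| ≤ C) (hwp : ∀ t (m : ℤ), w (t + m) = w t) :
    ∃ x ∈ liftedSimplex n ∩ {x | x 0 ∈ Icc (0 : ℝ) 1},
      (∀ x' ∈ liftedSimplex n, regMax ν K w 0 x ≤ regMax ν K w 0 x') ∧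
      ∀ j, regArcMax ν K w j 0 x = regMax ν K w 0 x := by
  choose X hX hXmin using exists_minimal_regMax (n := n) hν hK hw
  let e : ℕ → ℝ := fun k => 1 / ((k : ℝ) + 1)
  have he : Tendsto e atTop (𝓝 0) := tendsto_one_div_add_atTop_nhds_zero_nat
  have he0 : ∀ k, 0 < e k := fun k => by positivity
  obtain ⟨x, hx, φ, hφ, hlim⟩ := (isCompact_liftedSimplex_inter n).tendsto_subseq
    fun k => hX (e k)
  have hp : Tendsto (fun k => e (φ k)) atTop (𝓝 0) := he.comp hφ.tendsto_atTop
  have hV := ((continuous_regMax hν hK hw).tendsto (0, x)).comp (hp.prodMk_nhds hlim)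
  refine ⟨x, hx, fun x' hx' => ?_, fun j => ?_⟩
  · have hV' := ((continuous_regMax hν hK hw).tendsto (0, x')).comp
      (hp.prodMk_nhds tendsto_const_nhds)
    exact le_of_tendsto_of_tendsto' hV hV' fun k => hXmin _ _ hx'
  · have hA := ((continuous_regArcMax hν hK hw j).tendsto (0, x)).comp (hp.prodMk_nhds hlim)
    refine tendsto_nhds_unique hA (hV.congr fun k => ?_)
    exact (regArcMax_eq_of_minimal hν hconc hK hw0 hw hwp (he0 _) (hX _).1 (hX _).2
      (hXmin _) j).symm

/-! ### Exponentials of extended reals. -/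

/-- The exponential of an extended real as a real number, for arguments below `⊤`. -/
def expReal (z : EReal) : ℝ := (EReal.exp z).toReal

theorem expReal_nonneg (z : EReal) : 0 ≤ expReal z := ENNReal.toReal_nonneg

theorem expReal_coe (r : ℝ) : expReal r = Real.exp r := by
  simp [expReal, (Real.exp_pos r).le]

theorem expReal_bot : expReal ⊥ = 0 := by simp [expReal]

/-- No finiteness is needed: `⊥ + ⊤ = ⊥` matches `0 * ⊤ = 0`. -/
theorem expReal_add (a b : EReal) : expReal (a + b) = expReal a * expReal b := by
  simp [expReal, EReal.exp_add]

theorem expReal_le_expReal {a b : EReal} (ha : a ≠ ⊤) (hb : b ≠ ⊤) :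
    expReal a ≤ expReal b ↔ a ≤ b := by
  rw [expReal, expReal, ENNReal.toReal_le_toReal (by simpa using ha) (by simpa using hb),
    EReal.exp_le_exp_iff]

theorem expReal_pos {z : EReal} (h : z ≠ ⊥) (h' : z ≠ ⊤) : 0 < expReal z :=
  ENNReal.toReal_pos (by simpa using h) (by simpa using h')

theorem expReal_coe_mul {c : ℝ} (hc : 0 < c) {z : EReal} (hz : z ≠ ⊤) :
    expReal (c * z) = expReal z ^ c := by
  induction z with
  | bot => rw [EReal.coe_mul_bot_of_pos hc, expReal_bot, Real.zero_rpow hc.ne']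
  | coe r => rw [← EReal.coe_mul, expReal_coe, expReal_coe, ← Real.exp_mul, mul_comm]
  | top => exact absurd rfl hz

theorem coe_mul_ne_top {c : ℝ} (hc : 0 < c) {z : EReal} (hz : z ≠ ⊤) : (c : EReal) * z ≠ ⊤ := by
  induction z with
  | bot => rw [EReal.coe_mul_bot_of_pos hc]; exact bot_ne_top
  | coe r => rw [← EReal.coe_mul]; exact EReal.coe_ne_top _
  | top => exact absurd rfl hz

theorem expReal_sum {ι : Type*} (s : Finset ι) (f : ι → EReal) :
    expReal (∑ i ∈ s, f i) = ∏ i ∈ s, expReal (f i) := by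
  classical
  induction s using Finset.induction_on with
  | empty => simp [expReal]
  | insert a s ha ih => rw [Finset.sum_insert ha, Finset.prod_insert ha, expReal_add, ih]

theorem sum_ne_top {ι : Type*} (s : Finset ι) {f : ι → EReal} (h : ∀ i ∈ s, f i ≠ ⊤) :
    ∑ i ∈ s, f i ≠ ⊤ := by
  classical
  induction s using Finset.induction_on with
  | empty => simp
  | insert a s ha ih =>
    rw [Finset.sum_insert ha]
    exact EReal.add_ne_top (h a (Finset.mem_insert_self a s))
      (ih fun i hi => h i (Finset.mem_insert_of_mem hi))

variable {K : ℝ → ℝ}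

/-! ### Singular periodic kernels and their exponentials. -/

theorem zero_mem_closure_kernelDomain : (0 : ℝ) ∈ closure kernelDomain := by
  refine closure_mono (subset_union_right : Ioo (0 : ℝ) 1 ⊆ kernelDomain) ?_
  rw [closure_Ioo one_ne_zero.symm]
  exact ⟨le_rfl, zero_le_one⟩

theorem tendsto_atBot_of_singular (hK : IsKernel K) (hKs : IsSingular K) :
    Tendsto K (𝓝[>] 0) atBot ∧ Tendsto K (𝓝[<] 0) atBot := by
  obtain ⟨l, h1, h2⟩ := hK.limit_zero
  have h : Tendsto (fun t => (K t : EReal)) (𝓝[kernelDomain] 0) (𝓝 l) := by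
    rw [kernelDomain, nhdsWithin_union]
    exact Tendsto.sup (h2.mono_left (nhdsWithin_mono _ fun t ht => ht.2))
      (h1.mono_left (nhdsWithin_mono _ fun t ht => ht.1))
  have hl : l = ⊥ := (extendFrom_eq zero_mem_closure_kernelDomain h).symm.trans hKs
  subst hl
  exact ⟨EReal.tendsto_coe_nhds_bot_iff.1 h1, EReal.tendsto_coe_nhds_bot_iff.1 h2⟩

/-- Concavity gives continuity inside `(0,1)`. The exponential tends to `0` at `0` by singularity,
and at `1` because periodicity carries over the left limit at `0`. -/
theorem continuous_expKernel (hK : IsKernel K) (hKs : IsSingular K) (hKp : IsPeriodicKernel K) :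
    Continuous (expKernel K) := by
  classical
  obtain ⟨t0, t0'⟩ := tendsto_atBot_of_singular hK hKs
  have t1 : Tendsto K (𝓝[<] 1) atBot := by
    have hs : Tendsto (fun t : ℝ => t - 1) (𝓝[<] 1) (𝓝[<] 0) := by
      refine tendsto_nhdsWithin_iff.2 ⟨?_, ?_⟩
      · have : Tendsto (fun t : ℝ => t - 1) (𝓝 1) (𝓝 (1 - 1)) := Continuous.tendsto (by fun_prop) 1
        rw [sub_self] at this
        exact this.mono_left nhdsWithin_le_nhds
      · filter_upwards [self_mem_nhdsWithin] with t ht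
        exact sub_neg.2 (mem_Iio.1 ht)
    refine (t0'.comp hs).congr' ?_
    filter_upwards [Ioo_mem_nhdsLT (zero_lt_one' ℝ)] with t ht
    exact hKp t ht
  let f : ℝ → ℝ := fun s => if s ∈ Ioo (0 : ℝ) 1 then Real.exp (K s) else 0
  have hf : expKernel K = f ∘ Int.fract := by
    funext s
    have h0 := Int.fract_nonneg s
    have h1 := Int.fract_lt_one s
    simp only [expKernel, f, Function.comp_apply, mem_Ioo, h1, and_true]
    rcases h0.eq_or_lt with h | h
    · simp [← h]
    · simp [h, h.ne']
  have hint : ContinuousOn (fun s => Real.exp (K s)) (Ioo 0 1) :=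
    Real.continuous_exp.comp_continuousOn (hK.concaveOn_pos.continuousOn isOpen_Ioo)
  have f0 : f 0 = 0 := by simp [f]
  have f1 : f 1 = 0 := by simp [f]
  rw [hf]
  refine ContinuousOn.comp_fract'' ?_ (f0.trans f1.symm)
  intro s hs
  rcases hs.1.eq_or_lt with rfl | h0
  · have : Tendsto f (𝓝[>] 0) (𝓝 0) := by
      refine (Real.tendsto_exp_atBot.comp t0).congr' ?_
      filter_upwards [Ioo_mem_nhdsGT (zero_lt_one' ℝ)] with t ht
      simp [f, ht.1, ht.2]
    have h : ContinuousWithinAt f (Ioi 0) 0 := by rwa [ContinuousWithinAt, f0]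
    exact (continuousWithinAt_Ioi_iff_Ici.1 h).mono Icc_subset_Ici_self
  rcases hs.2.eq_or_lt with rfl | h1
  · have : Tendsto f (𝓝[<] 1) (𝓝 0) := by
      refine (Real.tendsto_exp_atBot.comp t1).congr' ?_
      filter_upwards [Ioo_mem_nhdsLT (zero_lt_one' ℝ)] with t ht
      simp [f, ht.1, ht.2]
    have h : ContinuousWithinAt f (Iio 1) 1 := by rwa [ContinuousWithinAt, f1]
    exact (continuousWithinAt_Iio_iff_Iic.1 h).mono Icc_subset_Iic_self
  · have hn : Ioo (0 : ℝ) 1 ∈ 𝓝 s := Ioo_mem_nhds h0 h1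
    refine ContinuousAt.continuousWithinAt ((hint.continuousAt hn).congr ?_)
    filter_upwards [hn] with t ht
    simp only [f, if_pos ht]

theorem coe_fract (s : ℝ) : ((Int.fract s : ℝ) : UnitAddCircle) = (s : UnitAddCircle) := by
  rw [← sub_eq_zero, ← AddCircle.coe_sub, AddCircle.coe_eq_zero_iff]
  exact ⟨-⌊s⌋, by rw [← Int.self_sub_floor]; simp⟩

theorem kernelTorus_coe (hK : IsKernel K) (hKs : IsSingular K) (s : ℝ) :
    kernelTorus K (s : UnitAddCircle) =
      if Int.fract s = 0 then ⊥ else (K (Int.fract s) : EReal) := by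
  have h0 := Int.fract_nonneg s
  have h1 := Int.fract_lt_one s
  rw [← coe_fract, kernelTorus, AddCircle.liftIco_coe_apply ⟨h0, by simpa using h1⟩]
  split_ifs with h
  · rw [h]; exact hKs
  · have hm : Int.fract s ∈ Ioo (0 : ℝ) 1 := ⟨lt_of_le_of_ne h0 (Ne.symm h), h1⟩
    have hc : ContinuousAt K (Int.fract s) :=
      (hK.concaveOn_pos.continuousOn isOpen_Ioo).continuousAt (isOpen_Ioo.mem_nhds hm)
    exact extendFrom_eq (subset_closure (Or.inr hm))
      ((continuous_coe_real_ereal.continuousAt.comp hc).tendsto.mono_left nhdsWithin_le_nhds)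

theorem kernelTorus_ne_top (hK : IsKernel K) (hKs : IsSingular K) (s : ℝ) :
    kernelTorus K (s : UnitAddCircle) ≠ ⊤ := by
  rw [kernelTorus_coe hK hKs]
  split_ifs
  · exact bot_ne_top
  · exact EReal.coe_ne_top _

theorem expReal_kernelTorus (hK : IsKernel K) (hKs : IsSingular K) (s : ℝ) :
    expReal (kernelTorus K (s : UnitAddCircle)) = expKernel K s := by
  rw [kernelTorus_coe hK hKs, expKernel]
  split_ifs
  · exact expReal_bot
  · exact expReal_coe _

/-! ### From the circle to the line. -/

section transfer

variable {n : ℕ} {ν : Fin n → ℝ} {J : UnitAddCircle → EReal} {x : Fin n → ℝ}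

theorem sumTranslates_ne_top (hν : ∀ j, 0 < ν j) (hK : IsKernel K) (hKs : IsSingular K)
    (hJ : ∀ t, J t ≠ ⊤) (x : Fin n → ℝ) (t : ℝ) :
    sumTranslates ν K J (fun j => (x j : UnitAddCircle)) (t : UnitAddCircle) ≠ ⊤ :=
  EReal.add_ne_top (hJ _) <| sum_ne_top _ fun j _ =>
    coe_mul_ne_top (hν j) (by rw [← AddCircle.coe_sub]; exact kernelTorus_ne_top hK hKs _)

theorem expReal_sumTranslates (hν : ∀ j, 0 < ν j) (hK : IsKernel K) (hKs : IsSingular K)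
    (x : Fin n → ℝ) (t : ℝ) :
    expReal (sumTranslates ν K J (fun j => (x j : UnitAddCircle)) (t : UnitAddCircle)) =
      expReal (J t) * regProd ν K 0 x t := by
  rw [sumTranslates, expReal_add, expReal_sum, regProd]
  congr 1
  refine Finset.prod_congr rfl fun j _ => ?_
  rw [← AddCircle.coe_sub, expReal_coe_mul (hν j) (kernelTorus_ne_top hK hKs _),
    expReal_kernelTorus hK hKs]
  simp [regKernel]

/-- The nodes occupy at most `n` points, so `J` is finite at some point off the nodes, where every
factor is positive. -/
theorem regMax_pos [NeZero n] (hν : ∀ j, 0 < ν j) (hKc : Continuous (expKernel K)) {C : ℝ}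
    (hw : ∀ t : ℝ, |expReal (J t)| ≤ C) (hwp : ∀ (t : ℝ) (m : ℤ), expReal (J (t + m : ℝ)) =
      expReal (J t)) (hJt : ∀ t, J t ≠ ⊤) (hJ : (n : ℕ∞) < {t | J t ≠ ⊥}.encard)
    (x : Fin n → ℝ) : 0 < regMax ν K (fun t => expReal (J t)) 0 x := by
  obtain ⟨t, ht, htx⟩ : ∃ t, J t ≠ ⊥ ∧ t ∉ range fun j => (x j : UnitAddCircle) := by
    by_contra! h
    refine hJ.not_ge ((encard_le_encard (fun t ht => h t ht)).trans ?_)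
    rw [← image_univ]
    refine (encard_image_le _ _).trans ?_
    simp
  obtain ⟨s, rfl⟩ := QuotientAddGroup.mk_surjective t
  refine lt_of_lt_of_le ?_ (le_regMax hν hKc hw hwp 0 x s)
  refine mul_pos (expReal_pos ht (hJt _)) (Finset.prod_pos fun j _ => Real.rpow_pos_of_pos
    (mul_pos ?_ (Real.exp_pos _)) _)
  have hne : Int.fract (s - x j) ≠ 0 := fun h0 => htx ⟨j, by
    have h1 := coe_fract (s - x j)
    rw [h0, AddCircle.coe_zero, AddCircle.coe_sub] at h1
    exact (sub_eq_zero.1 h1.symm).symm⟩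
  rw [expKernel, if_neg hne]
  exact Real.exp_pos _

theorem offset_coe {a b : ℝ} (h : b ∈ Ico a (a + 1)) :
    offset (a : UnitAddCircle) (b : UnitAddCircle) = b - a := by
  rw [offset, ← AddCircle.coe_sub]
  exact AddCircle.equivIco_coe_of_mem ⟨by linarith [h.1], by linarith [h.2]⟩

theorem coe_nextNode [NeZero n] (x : Fin n → ℝ) (j : Fin n) :
    (nextNode x j : UnitAddCircle) = (x (j + 1) : UnitAddCircle) := by
  unfold nextNode
  split_ifs
  · rw [AddCircle.coe_add, AddCircle.coe_period, add_zero]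
  · rw [add_zero]

theorem coe_mem_nodeArc [NeZero n] (hx : StrictMono x) (hx1 : ∀ i j, x j < x i + 1) {j : Fin n}
    {t : ℝ} (ht : t ∈ Icc (x j) (nextNode x j)) :
    (t : UnitAddCircle) ∈ nodeArc (fun j => (x j : UnitAddCircle)) j := by
  have hS : x ∈ liftedSimplex n := ⟨hx.monotone, fun i j => (hx1 i j).le⟩
  rcases (nextNode_le hS j).eq_or_lt with h | h
  -- An arc of length `1` has offset `0` between its ends, so it needs the full-turn clause;
  -- strictness of the order forces a single node.
  · right
    unfold nextNode at h
    rcases add_one_cases j with hj | hj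
    · rw [if_pos hj.1, hj.1, add_left_inj] at h
      refine ⟨hj.1, fun i => ?_⟩
      have : i = 0 := le_antisymm ((hj.2 i).trans (hx.injective h).ge) (Fin.zero_le i)
      rw [this]
    · rw [if_neg hj.1, add_zero] at h
      exact absurd h (hx1 _ _).ne
  · left
    change offset (x j : UnitAddCircle) t ≤ offset (x j : UnitAddCircle) (x (j + 1) : UnitAddCircle)
    rw [← coe_nextNode, offset_coe ⟨ht.1, ht.2.trans_lt h⟩,
      offset_coe ⟨ht.1.trans ht.2, h⟩]
    linarith [ht.2]

end transfer

end SumOfTranslates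

end

/-! ### Assembly of the theorem. -/

theorem mainTheorem4 (n : ℕ) [NeZero n] (ν : Fin n → ℝ) (hν : ∀ j, 0 < ν j)
    (K : ℝ → ℝ) (hK : SumOfTranslates.IsKernel K) (hKs : SumOfTranslates.IsSingular K)
    (hKp : SumOfTranslates.IsPeriodicKernel K)
    (J : UnitAddCircle → EReal) (hJ : SumOfTranslates.IsFieldFunction n J) :
    ∃ w : Fin n → UnitAddCircle,
      SumOfTranslates.IsMinimaxPoint ν K J w ∧
      w ∈ SumOfTranslates.openCyclicSimplex n ∧
      SumOfTranslates.IsEquioscillationPoint ν K J w := by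
  open SumOfTranslates in
  obtain ⟨C, hC⟩ := hJ.bddAbove
  have hJt : ∀ t, J t ≠ ⊤ := fun t => ((hC t).trans_lt (EReal.coe_lt_top C)).ne
  have hKc := continuous_expKernel hK hKs hKp
  have hw0 : ∀ t : ℝ, 0 ≤ expReal (J t) := fun t => expReal_nonneg _
  have hw : ∀ t : ℝ, |expReal (J t)| ≤ Real.exp C := fun t => by
    rw [abs_of_nonneg (hw0 t), ← expReal_coe, expReal_le_expReal (hJt _) (EReal.coe_ne_top C)]
    exact hC t
  have hwp : ∀ (t : ℝ) (m : ℤ), expReal (J (t + m : ℝ)) = expReal (J t) := fun t m => by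
    rw [← coe_fract (t + m), Int.fract_add_intCast, coe_fract]
  obtain ⟨x, ⟨hx, hx0⟩, hmin, harc⟩ := exists_minimal_equioscillating hν hK.concaveOn_pos hKc
    hw0 hw hwp
  have hpos := regMax_pos hν hKc hw hwp hJt hJ.finite_values x
  have hlt : ∀ j, x j < nextNode x j := by
    intro j
    -- A degenerate arc would have supremum at most `0`, but by equioscillation it carries the
    -- positive global one.
    refine (le_nextNode hx j).lt_of_ne fun h => hpos.not_ge ?_
    rw [← harc j]
    exact regArcMax_le hν 0 (le_nextNode hx j) le_rfl fun t ht => absurd (ht.1.trans ht.2) h.not_lt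
  have hx1 : ∀ i k, x k < x i + 1 := by
    intro i k
    refine (hlt k).trans_le ?_
    unfold nextNode
    rcases add_one_cases k with h | h
    · rw [if_pos h.1, h.1]; gcongr; exact hx.1 (Fin.zero_le _)
    · rw [if_neg h.1, add_zero]; exact hx.2 _ _
  have hxs : StrictMono x := by
    intro i k hik
    have h := hlt i
    unfold nextNode at h
    rcases add_one_cases i with h' | h'
    · exact absurd (h'.2 k) hik.not_ge
    · rw [if_neg h'.1, add_zero] at h
      exact h.trans_le (hx.1 (h'.2.2 k hik))
  have hFt := fun y t => sumTranslates_ne_top (n := n) hν hK hKs hJt y t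
  have hFe := fun y t => expReal_sumTranslates (n := n) (J := J) hν hK hKs y t
  have hFV : ∀ t : ℝ, expReal (sumTranslates ν K J (fun j => (x j : UnitAddCircle)) t) ≤
      regMax ν K (fun t => expReal (J t)) 0 x := fun t => by
    rw [hFe]; exact le_regMax hν hKc hw hwp 0 x t
  have hclosed : (fun j => (x j : UnitAddCircle)) ∈ closedCyclicSimplex n :=
    ⟨x, hx.1, hx.2, fun _ => rfl⟩
  refine ⟨fun j => x j, ⟨hclosed, le_antisymm (le_iInf₂ fun y hy => ?_) (iInf₂_le _ hclosed)⟩,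
    ⟨x, hxs, hx1, fun _ => rfl⟩, ?_⟩
  · obtain ⟨x', hx'm, hx'1, hy⟩ := hy
    obtain rfl : y = fun j => (x' j : UnitAddCircle) := funext hy
    -- `expReal` sends `⊤` to `0`, so it reflects the order only below `⊤`.
    by_cases htop : maxValue ν K J (fun j => (x' j : UnitAddCircle)) = ⊤
    · rw [htop]; exact le_top
    refine iSup_le fun t => ?_
    obtain ⟨s, rfl⟩ := QuotientAddGroup.mk_surjective t
    refine (expReal_le_expReal (hFt x s) htop).1 ((hFV s).trans ((hmin x' ⟨hx'm, hx'1⟩).trans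
      (weightedSup_le fun t _ => ?_)))
    rw [← hFe, expReal_le_expReal (hFt x' t) htop]
    exact le_iSup (sumTranslates ν K J fun j => (x' j : UnitAddCircle)) (t : UnitAddCircle)
  · have key : ∀ j, arcMax ν K J (fun j => (x j : UnitAddCircle)) j =
        maxValue ν K J fun j => (x j : UnitAddCircle) := by
      intro j
      refine le_antisymm (iSup₂_le fun t _ => le_iSup (sumTranslates ν K J _) t) ?_
      by_cases htop : arcMax ν K J (fun j => (x j : UnitAddCircle)) j = ⊤
      · rw [htop]; exact le_top
      refine iSup_le fun t => ?_
      obtain ⟨s, rfl⟩ := QuotientAddGroup.mk_surjective t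
      refine (expReal_le_expReal (hFt x s) htop).1 ((hFV s).trans ?_)
      rw [← harc j]
      refine regArcMax_le hν 0 (le_nextNode hx j) (expReal_nonneg _) fun t ht => ?_
      rw [← hFe, expReal_le_expReal (hFt x t) htop]
      exact le_iSup₂ (f := fun t _ => sumTranslates ν K J (fun j => (x j : UnitAddCircle)) t)
        (t : UnitAddCircle) (coe_mem_nodeArc hxs hx1 ⟨ht.1.le, ht.2.le⟩)
    exact fun i j => (key i).trans (key j).symm
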